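/- Let $n\ge 0$, let $A_{-1}\in\mathbb R^{n\times n}$, and let $A_2,A_3$ be $n\times n$-matrix functions on $(-1,0)$ whose entries belong to $L_2(-1,0)$. Let $M_2=\mathbb R^n\times L_2(-1,0;\mathbb R^n)$ with its Hilbert space norm, and let $\tilde{\mathcal A}$ be the unbounded linear operator in $M_2$ defined by $$\tilde{\mathcal A}\begin{pmatrix} w\\ \psi(\cdot)\end{pmatrix}=\begin{pmatrix} A_2(0)w+\psi(0)\\ -\dfrac{d[\psi(\theta)+A_2(\theta)w]}{d\theta}+A_3(\theta)w\end{pmatrix},$$ $$D(\tilde{\mathcal A})=\left\{(w,\psi(\cdot))\in M_2:\ \psi(\theta)+A_2(\theta)w\in H^1([-1,0];\mathbb R^n),\ (A_{-1}A_2(0)-A_2(-1))w=\psi(-1)-A_{-1}\psi(0)\right\}.$$ Here the values at $0$ and $-1$ are understood through the continuous representative $r$ of $\theta\mapsto\psi(\theta)+A_2(\theta)w$: $A_2(0)w+\psi(0)$ means $r(0)$, and the boundary condition means $r(-1)=A_{-1}r(0)$. Let $J\subseteq\mathbb R$ be an interval (for instance $J=[0,\infty)$), and let $x(t)=\begin{pmatrix}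 w(t)\\ \psi_t(\cdot)\end{pmatrix}$ be a classical solution on $J$ of $\dot x=\tilde{\mathcal A}x$, that is, $x:J\to M_2$ is continuously differentiable (one-sidedly at end points of $J$ belonging to $J$), $x(t)\in D(\tilde{\mathcal A})$ and $\dot x(t)=\tilde{\mathcal A}x(t)$ for all $t\in J$. Then $w$ is a solution on $J$ of the neutral type equation: $w$ is continuously differentiable on $J$ and, for every $t$ with $t\in J$ and $t+1\in J$ (so for every $t\ge 0$ if $J=[0,\infty)$), the integrand below is integrable on $(-1,0)$ and $$\dot w(t+1)=A_{-1}\dot w(t)+\int_{-1}^0\left[A_2(\tau)\dot w(t+1+\tau)+A_3(\tau)w(t+1+\tau)\right]d\tau .$$ -/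

import Mathlib

open MeasureTheory Set

namespace NeutralType

noncomputable section

/-- The space of column vectors `ℝⁿ`. -/
abbrev Vec (n : ℕ) : Type := EuclideanSpace ℝ (Fin n)

/-- Lebesgue measure on the delay interval `(-1, 0)`
(as an endpoint is a null set, it does not matter whether it is included). -/
abbrev delayMeasure : Measure ℝ := volume.restrict (Ioc (-1 : ℝ) 0)

/-- The space `L₂(-1, 0; ℝⁿ)`. -/
abbrev L2Vec (n : ℕ) : Type := Lp (Vec n) 2 delayMeasure

/-- The Hilbert space `M₂ = ℝⁿ × L₂(-1, 0; ℝⁿ)`, with the norm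
`‖(w, ψ)‖² = ‖w‖² + ‖ψ‖²`; the components of `x` are `x.fst` and `x.snd`. -/
abbrev M2 (n : ℕ) : Type := WithLp 2 (Vec n × L2Vec n)

/-- The entries of the matrix function `A` belong to `L₂(-1, 0)`. -/
def MatrixL2 {n : ℕ} (A : ℝ → Matrix (Fin n) (Fin n) ℝ) : Prop :=
  ∀ i j, MemLp (fun θ => A θ i j) 2 delayMeasure

/-- `r ∈ H¹([-1, 0]; ℝⁿ)`: `r` is absolutely continuous on `[-1, 0]` and its (almost everywhere
defined) derivative is square integrable. So `r` is the continuous representative of its class and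
its values at the points `-1` and `0` make sense. -/
def MemH1 {n : ℕ} (r : ℝ → Vec n) : Prop :=
  AbsolutelyContinuousOnInterval r (-1) 0 ∧ MemLp (deriv r) 2 delayMeasure

/-- `r` is the `H¹` representative of `θ ↦ ψ(θ) + A₂(θ) w`, where `(w, ψ) = x`. -/
def IsH1Rep {n : ℕ} (A2 : ℝ → Matrix (Fin n) (Fin n) ℝ) (x : M2 n) (r : ℝ → Vec n) : Prop :=
  MemH1 r ∧ r =ᵐ[delayMeasure] fun θ => x.snd θ + (A2 θ).toEuclideanLin x.fst

section helpers

variable {n : ℕ} {A2 A3 : ℝ → Matrix (Fin n) (Fin n) ℝ}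

theorem ae_differentiableAt_of_ac {r : ℝ → Vec n} (h : AbsolutelyContinuousOnInterval r (-1) 0) :
    ∀ᵐ θ ∂delayMeasure, DifferentiableAt ℝ r θ := by
  have h1 := h.boundedVariationOn.ae_differentiableAt_of_mem_uIcc
  rw [ae_restrict_iff' measurableSet_Ioc]
  filter_upwards [h1] with θ hθ hm
  exact hθ (by rw [uIcc_of_le (by norm_num)]; exact Ioc_subset_Icc_self hm)

theorem deriv_add_ae {r s : ℝ → Vec n} (hr : AbsolutelyContinuousOnInterval r (-1) 0)
    (hs : AbsolutelyContinuousOnInterval s (-1) 0) :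
    deriv (r + s) =ᵐ[delayMeasure] deriv r + deriv s := by
  filter_upwards [ae_differentiableAt_of_ac hr, ae_differentiableAt_of_ac hs] with θ h1 h2
  simpa using deriv_add h1 h2

theorem deriv_smul_ae {r : ℝ → Vec n} (c : ℝ) (hr : AbsolutelyContinuousOnInterval r (-1) 0) :
    deriv (c • r) =ᵐ[delayMeasure] c • deriv r := by
  filter_upwards [ae_differentiableAt_of_ac hr] with θ h1
  simpa using deriv_const_smul c h1

theorem MemH1.add {r s : ℝ → Vec n} (hr : MemH1 r) (hs : MemH1 s) : MemH1 (r + s) :=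
  ⟨hr.1.add hs.1, (memLp_congr_ae (deriv_add_ae hr.1 hs.1)).2 (hr.2.add hs.2)⟩

theorem MemH1.smul {r : ℝ → Vec n} (c : ℝ) (hr : MemH1 r) : MemH1 (c • r) :=
  ⟨hr.1.const_smul c, (memLp_congr_ae (deriv_smul_ae c hr.1)).2 (hr.2.const_smul c)⟩

theorem IsH1Rep.add {x y : M2 n} {r s : ℝ → Vec n} (hr : IsH1Rep A2 x r) (hs : IsH1Rep A2 y s) :
    IsH1Rep A2 (x + y) (r + s) := by
  refine ⟨hr.1.add hs.1, ?_⟩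
  filter_upwards [hr.2, hs.2, Lp.coeFn_add x.snd y.snd] with θ h1 h2 h3
  have h3' : (x + y).snd θ = x.snd θ + y.snd θ := by simpa using h3
  rw [Pi.add_apply, h1, h2, h3', WithLp.add_fst, map_add]
  abel

theorem IsH1Rep.smul {x : M2 n} {r : ℝ → Vec n} (c : ℝ) (hr : IsH1Rep A2 x r) :
    IsH1Rep A2 (c • x) (c • r) := by
  refine ⟨hr.1.smul c, ?_⟩
  filter_upwards [hr.2, Lp.coeFn_smul c x.snd] with θ h1 h3
  have h3' : (c • x).snd θ = c • x.snd θ := by simpa using h3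
  rw [Pi.smul_apply, h1, h3', WithLp.smul_fst, map_smul, smul_add]

theorem IsH1Rep.zero : IsH1Rep A2 (0 : M2 n) 0 := by
  refine ⟨⟨?_, ?_⟩, ?_⟩
  · have h : LipschitzOnWith 0 (0 : ℝ → Vec n) (uIcc (-1) 0) :=
      (LipschitzWith.const (0 : Vec n)).lipschitzOnWith
    exact h.absolutelyContinuousOnInterval
  · have : deriv (0 : ℝ → Vec n) = 0 := by ext1 θ; exact deriv_const θ (0 : Vec n)
    rw [this]
    exact MemLp.zero
  · filter_upwards [Lp.coeFn_zero (Vec n) 2 delayMeasure] with θ h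
    have h' : (0 : M2 n).snd θ = 0 := by simpa using h
    rw [h']
    simp

/-- The representative is unique on `[-1, 0]`. -/
theorem IsH1Rep.eqOn {x : M2 n} {r s : ℝ → Vec n} (hr : IsH1Rep A2 x r) (hs : IsH1Rep A2 x s) :
    EqOn r s (Icc (-1) 0) := by
  have hc : ∀ {u : ℝ → Vec n}, MemH1 u → ContinuousOn u (Icc (-1) 0) := fun hu => by
    have := hu.1.continuousOn
    rwa [uIcc_of_le (by norm_num)] at this
  refine Measure.eqOn_Icc_of_ae_eq volume (by norm_num) ?_ (hc hr.1) (hc hs.1)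
  rw [← Measure.restrict_congr_set (Ioc_ae_eq_Icc (a := (-1 : ℝ)) (b := 0))]
  exact hr.2.trans hs.2.symm

theorem IsH1Rep.deriv_ae {x : M2 n} {r s : ℝ → Vec n} (hr : IsH1Rep A2 x r)
    (hs : IsH1Rep A2 x s) : deriv r =ᵐ[delayMeasure] deriv s := by
  have h := hr.eqOn hs
  rw [delayMeasure, ← Measure.restrict_congr_set (Ioo_ae_eq_Ioc (a := (-1 : ℝ)) (b := 0))]
  refine (ae_restrict_iff' measurableSet_Ioo).2 (Filter.Eventually.of_forall fun θ hθ => ?_)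
  refine Filter.EventuallyEq.deriv_eq ?_
  filter_upwards [Ioo_mem_nhds hθ.1 hθ.2] with τ hτ using h (Ioo_subset_Icc_self hτ)

theorem MatrixL2.memLp_apply (hA3 : MatrixL2 A3) (w : Vec n) :
    MemLp (fun θ => (A3 θ).toEuclideanLin w) 2 delayMeasure := by
  refine MemLp.of_eval_piLp fun i => ?_
  have : (fun θ => ((A3 θ).toEuclideanLin w) i) = fun θ => ∑ j, A3 θ i j * w j := by
    ext θ
    simp [Matrix.mulVec, dotProduct]
  rw [this]
  refine memLp_finsetSum _ fun j _ => ?_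
  simpa [mul_comm] using (hA3 i j).const_mul (w j)

theorem memLp_value (hA3 : MatrixL2 A3) (w : Vec n) {r : ℝ → Vec n} (hr : MemH1 r) :
    MemLp (fun θ => -deriv r θ + (A3 θ).toEuclideanLin w) 2 delayMeasure :=
  hr.2.neg.add (hA3.memLp_apply w)

end helpers

/-- The domain of the operator `Ã`: the pairs `(w, ψ) ∈ M₂` such that
`r(θ) = ψ(θ) + A₂(θ) w` belongs to `H¹` and
`(A₋₁ A₂(0) - A₂(-1)) w = ψ(-1) - A₋₁ ψ(0)`. As `ψ` and `A₂` are elements of `L₂`, only the values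
of the sum `r` at the end points make sense, and the condition reads `r(-1) = A₋₁ r(0)`. -/
def tildeADomain {n : ℕ} (Am1 : Matrix (Fin n) (Fin n) ℝ) (A2 : ℝ → Matrix (Fin n) (Fin n) ℝ) :
    Submodule ℝ (M2 n) where
  carrier := {x | ∃ r : ℝ → Vec n, IsH1Rep A2 x r ∧ r (-1) = Am1.toEuclideanLin (r 0)}
  zero_mem' := ⟨0, IsH1Rep.zero, by simp⟩
  add_mem' := by
    rintro x y ⟨r, hr, hr'⟩ ⟨s, hs, hs'⟩
    exact ⟨r + s, hr.add hs, by rw [Pi.add_apply, Pi.add_apply, hr', hs', map_add]⟩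
  smul_mem' := by
    rintro c x ⟨r, hr, hr'⟩
    exact ⟨c • r, hr.smul c, by rw [Pi.smul_apply, Pi.smul_apply, hr', map_smul]⟩

/-- The absolutely continuous function `r = ψ + A₂ w` for `(w, ψ)` in the domain of `Ã`. -/
def h1Rep {n : ℕ} {Am1 : Matrix (Fin n) (Fin n) ℝ} {A2 : ℝ → Matrix (Fin n) (Fin n) ℝ}
    (x : tildeADomain Am1 A2) : ℝ → Vec n :=
  Classical.choose x.2

theorem h1Rep_spec {n : ℕ} {Am1 : Matrix (Fin n) (Fin n) ℝ} {A2 : ℝ → Matrix (Fin n) (Fin n) ℝ}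
    (x : tildeADomain Am1 A2) : IsH1Rep A2 (x : M2 n) (h1Rep x) :=
  (Classical.choose_spec x.2).1

/-- The unbounded operator `Ã` in `M₂`,
`Ã (w, ψ) = (A₂(0) w + ψ(0), - d[ψ(θ) + A₂(θ) w]/dθ + A₃(θ) w)`, that is
`Ã (w, ψ) = (r(0), - r' + A₃ w)` with `r = ψ + A₂ w ∈ H¹`. -/
def tildeA {n : ℕ} (Am1 : Matrix (Fin n) (Fin n) ℝ) (A2 A3 : ℝ → Matrix (Fin n) (Fin n) ℝ)
    (hA3 : MatrixL2 A3) : M2 n →ₗ.[ℝ] M2 n where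
  domain := tildeADomain Am1 A2
  toFun :=
    { toFun := fun x => WithLp.toLp 2
        (h1Rep x 0,
          (memLp_value hA3 (x : M2 n).fst (h1Rep_spec x).1).toLp
            (fun θ => -deriv (h1Rep x) θ + (A3 θ).toEuclideanLin (x : M2 n).fst))
      map_add' := by
        intro x y
        have hxy := (h1Rep_spec x).add (h1Rep_spec y)
        refine congrArg (WithLp.toLp 2) (Prod.ext ?_ ?_)
        · exact (h1Rep_spec (x + y)).eqOn hxy (by norm_num)
        · refine Eq.trans ?_ (MemLp.toLp_add
            (memLp_value hA3 (x : M2 n).fst (h1Rep_spec x).1)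
            (memLp_value hA3 (y : M2 n).fst (h1Rep_spec y).1))
          refine MemLp.toLp_congr (memLp_value hA3 _ (h1Rep_spec (x + y)).1) _ ?_
          filter_upwards [(h1Rep_spec (x + y)).deriv_ae hxy,
            deriv_add_ae (h1Rep_spec x).1.1 (h1Rep_spec y).1.1] with θ h1 h2
          rw [h1, h2]
          simp only [Pi.add_apply, Submodule.coe_add, WithLp.add_fst, map_add]
          abel
      map_smul' := by
        intro c x
        have hx := (h1Rep_spec x).smul c
        refine congrArg (WithLp.toLp 2) (Prod.ext ?_ ?_)
        · exact (h1Rep_spec (c • x)).eqOn hx (by norm_num)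
        · refine Eq.trans ?_ (MemLp.toLp_const_smul c
            (memLp_value hA3 (x : M2 n).fst (h1Rep_spec x).1))
          refine MemLp.toLp_congr (memLp_value hA3 _ (h1Rep_spec (c • x)).1) _ ?_
          filter_upwards [(h1Rep_spec (c • x)).deriv_ae hx,
            deriv_smul_ae c (h1Rep_spec x).1.1] with θ h1 h2
          rw [h1, h2]
          simp only [Pi.smul_apply, SetLike.val_smul, WithLp.smul_fst, map_smul, smul_add,
            smul_neg] }

/-- `x` is a (classical) solution of the abstract equation `ẋ = A x` on the interval `J`: it is
continuously differentiable on `J` (one-sidedly at end points that belong to `J`), takes its values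
in the domain of `A`, and satisfies the equation at every time of `J`. -/
structure IsClassicalSolutionOn {X : Type*} [NormedAddCommGroup X] [NormedSpace ℝ X]
    (A : X →ₗ.[ℝ] X) (J : Set ℝ) (x : ℝ → X) : Prop where
  mem_domain : ∀ t ∈ J, x t ∈ A.domain
  hasDerivWithinAt : ∀ t (ht : t ∈ J), HasDerivWithinAt x (A ⟨x t, mem_domain t ht⟩) J t
  continuous_deriv : Continuous fun t : J => A ⟨x t, mem_domain t t.2⟩

/-- `w` is a solution on the interval `J` of the neutral type equation
`ẇ(t+1) = A₋₁ ẇ(t) + ∫_{-1}^0 [A₂(τ) ẇ(t+1+τ) + A₃(τ) w(t+1+τ)] dτ`: it is continuously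
differentiable on `J` and, for all `t` such that `t` and `t + 1` belong to `J`, the integrand is
integrable and the equation holds. -/
structure IsNeutralSolutionOn {n : ℕ} (Am1 : Matrix (Fin n) (Fin n) ℝ)
    (A2 A3 : ℝ → Matrix (Fin n) (Fin n) ℝ) (J : Set ℝ) (w : ℝ → Vec n) : Prop where
  differentiableOn : DifferentiableOn ℝ w J
  continuousOn_deriv : ContinuousOn (derivWithin w J) J
  integrable : ∀ t, t ∈ J → t + 1 ∈ J → IntervalIntegrable
    (fun τ => (A2 τ).toEuclideanLin (derivWithin w J (t + 1 + τ)) +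
      (A3 τ).toEuclideanLin (w (t + 1 + τ))) volume (-1) 0
  equation : ∀ t, t ∈ J → t + 1 ∈ J →
    derivWithin w J (t + 1) = Am1.toEuclideanLin (derivWithin w J t) +
      ∫ τ in (-1 : ℝ)..0, ((A2 τ).toEuclideanLin (derivWithin w J (t + 1 + τ)) +
        (A3 τ).toEuclideanLin (w (t + 1 + τ)))

end

end NeutralType

/-! Write `R(s, θ) = ψ_s(θ) + A₂(θ) w(s)`. The abstract equation says that `R` solves the transport
equation `R_s = -R_θ + A₃(θ) w(s) + A₂(θ) ẇ(s)`, with `R(s, 0) = ẇ(s)` and `R(s, -1) = A₋₁ ẇ(s)`.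
Integrating along the characteristic from `(t, -1)` to `(t + 1, 0)` gives the neutral equation.

A time derivative in `L₂` says nothing about a single characteristic, so all characteristics leaving
time `t` are averaged. The one through `(t, z - 1)`, `0 < z < 1`, reaches `θ = 0` at time `1 + t -
z`. Take `k` smooth with support in `(0, 1)` and pair `R(s, ·)` with the moving test function `k(θ +
1 + t - s) e`, which is constant along characteristics. Integration by parts in `θ`
(`MemH1.integral_deriv_smul`) removes `R_θ` from the derivative of the pairing
(`hasDerivWithinAt_inner_repL2`). Integrating over `[t, t + 1]` and applying Fubini
(`integral_kernel_eq_triangleIntegral`) yields `∫ k(z) Z(z) dz = 0`, where `Z(z)` is the defect of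
the integrated equation on characteristic `z` (`integral_smul_transport_eq_zero`).

Since `k` is arbitrary and `Z` is continuous on the closed interval `[0, 1]`
(`continuous_triangleIntegral`), `Z` vanishes up to `z = 0`, the characteristic wanted. The boundary
condition at `θ = -1` then gives the term `A₋₁ ẇ(t)`. -/

open Filter Topology ContDiff

namespace NeutralType

/-! ### The source term integrated along characteristics. -/

section TriangleIntegral

variable {V W : Type*} [NormedAddCommGroup V] [NormedSpace ℝ V] [NormedAddCommGroup W]
  [NormedSpace ℝ W]

/-- The integral of `θ ↦ a(θ) c(θ + b - y)` over the part of `(-1, 0)` where `y < θ + 1`. -/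
noncomputable def triangleIntegral (a : ℝ → V →L[ℝ] W) (c : ℝ → V) (b y : ℝ) : W :=
  ∫ θ, (if y < θ + 1 then a θ (c (θ + b - y)) else 0) ∂delayMeasure

theorem aestronglyMeasurable_ite_apply {a : ℝ → V →L[ℝ] W} (ha : Integrable a delayMeasure)
    {c : ℝ → V} (hc : Continuous c) (b y : ℝ) :
    AEStronglyMeasurable (fun θ => if y < θ + 1 then a θ (c (θ + b - y)) else 0)
      delayMeasure := by
  have h1 : AEStronglyMeasurable (fun θ => a θ (c (θ + b - y))) delayMeasure :=
    ContinuousLinearMap.aestronglyMeasurable_comp₂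
      (ContinuousLinearMap.id ℝ (V →L[ℝ] W)) ha.1
      (by fun_prop : Continuous fun θ => c (θ + b - y)).aestronglyMeasurable
  have h2 : MeasurableSet {θ : ℝ | y < θ + 1} :=
    (isOpen_lt continuous_const (continuous_id.add continuous_const)).measurableSet
  refine (h1.indicator h2).congr (Eventually.of_forall fun θ => ?_)
  simp [indicator_apply]

/-- Dominated convergence. This continuity is what later allows passing from almost every
characteristic to the extreme one, `y = 0`. -/
theorem continuous_triangleIntegral {a : ℝ → V →L[ℝ] W} (ha : Integrable a delayMeasure)
    {c : ℝ → V} (hc : Continuous c) {C : ℝ} (hC : ∀ s, ‖c s‖ ≤ C) (b : ℝ) :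
    Continuous (triangleIntegral a c b) := by
  have hC0 : 0 ≤ C := (norm_nonneg _).trans (hC 0)
  refine continuous_iff_continuousAt.2 fun y₀ => ?_
  refine continuousAt_of_dominated (bound := fun θ => ‖a θ‖ * C)
    (Eventually.of_forall fun y => aestronglyMeasurable_ite_apply ha hc b y)
    (Eventually.of_forall fun y => Eventually.of_forall fun θ => ?_) (ha.norm.mul_const C) ?_
  · split_ifs
    · exact (ContinuousLinearMap.le_opNorm _ _).trans (by gcongr; exact hC _)
    · simpa using mul_nonneg (norm_nonneg _) hC0
  -- For fixed `θ` the cutoff jumps at `y₀` only when `θ = y₀ - 1`, a null set.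
  · have hne : ∀ᵐ θ ∂delayMeasure, θ ≠ y₀ - 1 :=
      ae_restrict_of_ae (Measure.ae_ne volume (y₀ - 1))
    filter_upwards [hne] with θ hθ
    rcases lt_or_gt_of_ne (fun h : y₀ = θ + 1 => hθ (by linarith)) with h | h
    · have : ContinuousAt (fun y => a θ (c (θ + b - y))) y₀ := by fun_prop
      refine this.congr ?_
      filter_upwards [Iio_mem_nhds h] with y hy
      rw [if_pos (mem_Iio.1 hy)]
    · refine (continuousAt_const (y := (0 : W))).congr ?_
      filter_upwards [Ioi_mem_nhds h] with y hy
      rw [if_neg (not_lt.2 (le_of_lt hy))]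

/-- Fubini, the substitution `y = θ + 1 + t - s` labelling the characteristic through `(s, θ)`, and
Fubini again. -/
theorem integral_kernel_eq_triangleIntegral {a : ℝ → V →L[ℝ] W} (ha : Integrable a delayMeasure)
    {c : ℝ → V} (hc : Continuous c) {C : ℝ} (hC : ∀ s, ‖c s‖ ≤ C) {κ : ℝ → ℝ}
    (hκ : Continuous κ) (hκ' : HasCompactSupport κ) (hκ0 : ∀ y ∉ Ioo (0 : ℝ) 1, κ y = 0) (t : ℝ) :
    ∫ s in Ioc t (t + 1), ∫ θ, κ (θ + 1 + t - s) • a θ (c s) ∂delayMeasure =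
      ∫ y in Ioo (0 : ℝ) 1, κ y • triangleIntegral a c (1 + t) y := by
  obtain ⟨K, hK⟩ := hκ.bounded_above_of_compact_support hκ'
  have hC0 : 0 ≤ C := (norm_nonneg _).trans (hC 0)
  have hK0 : 0 ≤ K := (norm_nonneg _).trans (hK 0)
  rw [integral_integral_swap]
  · have inner : ∀ θ ∈ Ioc (-1 : ℝ) 0, ∫ s in Ioc t (t + 1), κ (θ + 1 + t - s) • a θ (c s) =
        ∫ y in Ioo (0 : ℝ) 1, κ y • (if y < θ + 1 then a θ (c (θ + (1 + t) - y)) else 0) := by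
      intro θ hθ
      rw [← integral_indicator measurableSet_Ioc, ← integral_sub_left_eq_self _ _ (θ + 1 + t),
        ← integral_indicator measurableSet_Ioo]
      congr 1 with y
      by_cases hy : y ∈ Ioo (0 : ℝ) 1
      · rw [indicator_of_mem hy]
        -- The cutoff is the condition `t < s`; the other bound `s ≤ t + 1` is automatic from `θ ≤ 0
        -- < y`.
        by_cases hy' : y < θ + 1
        · have : θ + 1 + t - y ∈ Ioc t (t + 1) :=
            ⟨by linarith, by linarith [hθ.2, hy.1]⟩
          rw [indicator_of_mem this, if_pos hy']
          congr 2
          · ring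
          · ring_nf
        · have : θ + 1 + t - y ∉ Ioc t (t + 1) := fun h => hy' (by linarith [h.1])
          rw [indicator_of_notMem this, if_neg hy', smul_zero]
      · rw [indicator_of_notMem hy, indicator_apply]
        split_ifs
        · rw [show θ + 1 + t - (θ + 1 + t - y) = y by ring, hκ0 y hy, zero_smul]
        · rfl
    rw [setIntegral_congr_fun measurableSet_Ioc inner, integral_integral_swap]
    · simp only [triangleIntegral, integral_smul]
    · have h1 : Integrable (fun p : ℝ × ℝ => ‖a p.1‖ * (K * C))
          (delayMeasure.prod (volume.restrict (Ioo (0 : ℝ) 1))) :=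
        ha.norm.mul_prod (integrable_const (K * C))
      refine h1.mono' ?_ (Eventually.of_forall fun p => ?_)
      · have h2 : AEStronglyMeasurable (fun p : ℝ × ℝ => a p.1 (c (p.1 + (1 + t) - p.2)))
            (delayMeasure.prod (volume.restrict (Ioo (0 : ℝ) 1))) :=
          ContinuousLinearMap.aestronglyMeasurable_comp₂
            (ContinuousLinearMap.id ℝ (V →L[ℝ] W)) ha.1.comp_fst
            (by fun_prop : Continuous fun p : ℝ × ℝ => c (p.1 + (1 + t) - p.2)).aestronglyMeasurable
        have h3 : MeasurableSet {p : ℝ × ℝ | p.2 < p.1 + 1} :=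
          (isOpen_lt continuous_snd (continuous_fst.add continuous_const)).measurableSet
        refine ((by fun_prop : Continuous fun p : ℝ × ℝ => κ p.2).aestronglyMeasurable.smul
          (h2.indicator h3)).congr (Eventually.of_forall fun p => ?_)
        simp [indicator_apply, Function.uncurry]
      · simp only [Function.uncurry, norm_smul]
        rw [mul_left_comm]
        gcongr
        · exact hK _
        · split_ifs
          · exact (ContinuousLinearMap.le_opNorm _ _).trans (by gcongr; exact hC _)
          · simpa using mul_nonneg (norm_nonneg _) hC0
  · have h1 : Integrable (fun p : ℝ × ℝ => (K * C) * ‖a p.2‖)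
        ((volume.restrict (Ioc t (t + 1))).prod delayMeasure) :=
      (integrable_const (K * C)).mul_prod ha.norm
    refine h1.mono' ?_ (Eventually.of_forall fun p => ?_)
    · exact (by fun_prop : Continuous fun p : ℝ × ℝ => κ (p.2 + 1 + t - p.1)).aestronglyMeasurable.smul
        (ContinuousLinearMap.aestronglyMeasurable_comp₂
          (ContinuousLinearMap.id ℝ (V →L[ℝ] W)) ha.1.comp_snd
          (by fun_prop : Continuous fun p : ℝ × ℝ => c p.1).aestronglyMeasurable)
    · simp only [Function.uncurry, norm_smul]
      rw [mul_assoc, mul_comm C]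
      gcongr
      · exact hK _
      · exact (ContinuousLinearMap.le_opNorm _ _).trans (by gcongr; exact hC _)

end TriangleIntegral

/-! ### Translation of a smooth test function as a differentiable curve in `L₂`. -/

section TestCurve

variable {n : ℕ}

theorem memLp_shift_smul {k : ℝ → ℝ} (hk : Continuous k) (b : ℝ) (e : Vec n) :
    MemLp (fun θ => k (θ + b) • e) 2 delayMeasure := by
  have hc : Continuous fun θ => k (θ + b) • e := by fun_prop
  obtain ⟨C, hC⟩ := isCompact_Icc.exists_bound_of_continuousOn (s := Icc (-1 : ℝ) 0) hc.continuousOn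
  refine MemLp.of_bound hc.aestronglyMeasurable C ?_
  exact (ae_restrict_iff' measurableSet_Ioc).2
    (Eventually.of_forall fun θ hθ => hC θ (Ioc_subset_Icc_self hθ))

/-- The function `θ ↦ k(θ + b) e` as an element of `L₂(-1, 0; ℝⁿ)`. -/
noncomputable def shiftL2 {k : ℝ → ℝ} (hk : Continuous k) (e : Vec n) (b : ℝ) : L2Vec n :=
  (memLp_shift_smul hk b e).toLp _

theorem abs_taylor_le {k : ℝ → ℝ} (hk : ContDiff ℝ 2 k) {C : ℝ}
    (hC : ∀ x, ‖deriv (deriv k) x‖ ≤ C) (x y : ℝ) :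
    ‖k y - k x - (y - x) * deriv k x‖ ≤ C * ‖y - x‖ ^ 2 := by
  have hd : Differentiable ℝ k := hk.differentiable (by norm_num)
  have hd' : Differentiable ℝ (deriv k) :=
    (ContDiff.deriv' (n := 1) hk).differentiable (by norm_num)
  have hlip : ∀ u v, ‖deriv k v - deriv k u‖ ≤ C * ‖v - u‖ := fun u v =>
    convex_univ.norm_image_sub_le_of_norm_deriv_le (fun z _ => hd' z) (fun z _ => hC z)
      (mem_univ u) (mem_univ v)
  have hC0 : 0 ≤ C := (norm_nonneg _).trans (hC 0)
  have hg : ∀ z, HasDerivAt (fun z => k z - z * deriv k x) (deriv k z - deriv k x) z := fun z => by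
    have := (hd z).hasDerivAt.sub ((hasDerivAt_id z).mul_const (deriv k x))
    rw [one_mul] at this
    exact this
  have := (convex_uIcc x y).norm_image_sub_le_of_norm_hasDerivWithin_le
    (f := fun z => k z - z * deriv k x) (C := C * ‖y - x‖)
    (fun z _ => (hg z).hasDerivWithinAt)
    (fun z hz => (hlip x z).trans (by
      gcongr
      simpa [Real.norm_eq_abs] using abs_sub_left_of_mem_uIcc hz)) left_mem_uIcc right_mem_uIcc
  calc ‖k y - k x - (y - x) * deriv k x‖
      = ‖k y - y * deriv k x - (k x - x * deriv k x)‖ := by congr 1; ring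
    _ ≤ C * ‖y - x‖ * ‖y - x‖ := this
    _ = _ := by ring

/-- The bound on the second derivative makes the Taylor remainder quadratic uniformly in `θ`, hence
quadratic in the `L₂` norm. -/
theorem hasDerivAt_shiftL2 {k : ℝ → ℝ} (hk : ContDiff ℝ 2 k) (hk' : Continuous (deriv k)) {C : ℝ}
    (hC : ∀ x, ‖deriv (deriv k) x‖ ≤ C) (e : Vec n) (b : ℝ) :
    HasDerivAt (shiftL2 hk.continuous e) (shiftL2 hk' e b) b := by
  have hC0 : 0 ≤ C := (norm_nonneg _).trans (hC 0)
  set f := shiftL2 hk.continuous e with hf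
  have key : ∀ b', ‖f b' - f b - (b' - b) • shiftL2 hk' e b‖ ≤ (C * ‖e‖) * ‖b' - b‖ ^ 2 := by
    intro b'
    have hae : ∀ᵐ θ ∂delayMeasure,
        ‖(f b' - f b - (b' - b) • shiftL2 hk' e b : L2Vec n) θ‖ ≤ C * ‖e‖ * ‖b' - b‖ ^ 2 := by
      filter_upwards [Lp.coeFn_sub (f b' - f b) ((b' - b) • shiftL2 hk' e b),
        Lp.coeFn_sub (f b') (f b), Lp.coeFn_smul (b' - b) (shiftL2 hk' e b),
        (memLp_shift_smul hk.continuous b' e).coeFn_toLp,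
        (memLp_shift_smul hk.continuous b e).coeFn_toLp,
        (memLp_shift_smul hk' b e).coeFn_toLp] with θ h1 h2 h3 h4 h5 h6
      have h4' : f b' θ = k (θ + b') • e := h4
      have h5' : f b θ = k (θ + b) • e := h5
      have h6' : shiftL2 hk' e b θ = deriv k (θ + b) • e := h6
      rw [h1, Pi.sub_apply, h2, Pi.sub_apply, h3, Pi.smul_apply, h4', h5', h6', smul_smul,
        ← sub_smul, ← sub_smul, norm_smul]
      have := abs_taylor_le hk hC (θ + b) (θ + b')
      rw [add_sub_add_left_eq_sub] at this
      calc _ ≤ C * ‖b' - b‖ ^ 2 * ‖e‖ := by gcongr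
        _ = _ := by ring
    refine (Lp.norm_le_of_ae_bound (by positivity) hae).trans_eq ?_
    simp [measureUnivNNReal]
  have hO : (fun b' => f b' - f b - (b' - b) • shiftL2 hk' e b) =O[𝓝 b]
      fun b' => ‖b' - b‖ ^ 2 :=
    Asymptotics.IsBigO.of_bound (C * ‖e‖) (Eventually.of_forall fun b' => by
      simpa using key b')
  have h0 := (hO.hasFDerivAt (by norm_num)).hasDerivAt
  have h1 : HasDerivAt (fun b' => f b + (b' - b) • shiftL2 hk' e b) (shiftL2 hk' e b) b := by
    simpa using (((hasDerivAt_id b).sub_const b).smul_const (shiftL2 hk' e b)).const_add (f b)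
  have h2 := h0.add h1
  simp only [zero_apply, zero_add] at h2
  refine h2.congr_of_eventuallyEq (Eventually.of_forall fun b' => ?_)
  simp only [Pi.add_apply]
  abel

end TestCurve

/-! ### Matrix functions as integrable operator-valued functions and as operators into `L₂`. -/

section Matrix

variable {n : ℕ}

/-- Expanding in matrix units reduces the claim to the scalar entries, which are integrable because
the interval has finite measure. -/
theorem MatrixL2.integrable_map {E : Type*} [NormedAddCommGroup E] [NormedSpace ℝ E]
    {A : ℝ → Matrix (Fin n) (Fin n) ℝ} (hA : MatrixL2 A)
    (L : Matrix (Fin n) (Fin n) ℝ →ₗ[ℝ] E) :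
    Integrable (fun θ => L (A θ)) delayMeasure := by
  have h : (fun θ => L (A θ)) = fun θ => ∑ i, ∑ j, A θ i j • L (Matrix.single i j 1) := by
    ext1 θ
    conv_lhs => rw [Matrix.matrix_eq_sum_single (A θ)]
    simp only [map_sum, ← map_smul, Matrix.smul_single, smul_eq_mul, mul_one]
  rw [h]
  exact integrable_finsetSum _ fun i _ => integrable_finsetSum _ fun j _ =>
    ((hA i j).integrable (by norm_num)).smul_const _

/-- A matrix composed with a linear map into `ℝⁿ`, as a linear function of the matrix. -/
noncomputable def matrixCompCLM {V : Type*} [NormedAddCommGroup V] [NormedSpace ℝ V]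
    [FiniteDimensional ℝ V] (P : V →ₗ[ℝ] Vec n) :
    Matrix (Fin n) (Fin n) ℝ →ₗ[ℝ] (V →L[ℝ] Vec n) where
  toFun A := LinearMap.toContinuousLinearMap (A.toEuclideanLin ∘ₗ P)
  map_add' A B := by ext1 v; simp
  map_smul' c A := by ext1 v; simp

/-- The map `(w, v) ↦ A₃(θ) w + A₂(θ) v`. -/
noncomputable def delayCLM (A2 A3 : ℝ → Matrix (Fin n) (Fin n) ℝ) (θ : ℝ) :
    (Vec n × Vec n) →L[ℝ] Vec n :=
  matrixCompCLM (LinearMap.fst ℝ _ _) (A3 θ) + matrixCompCLM (LinearMap.snd ℝ _ _) (A2 θ)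

theorem delayCLM_apply (A2 A3 : ℝ → Matrix (Fin n) (Fin n) ℝ) (θ : ℝ) (w v : Vec n) :
    delayCLM A2 A3 θ (w, v) = (A3 θ).toEuclideanLin w + (A2 θ).toEuclideanLin v := rfl

theorem integrable_delayCLM {A2 A3 : ℝ → Matrix (Fin n) (Fin n) ℝ} (hA2 : MatrixL2 A2)
    (hA3 : MatrixL2 A3) : Integrable (delayCLM A2 A3) delayMeasure :=
  (hA3.integrable_map (matrixCompCLM (LinearMap.fst ℝ (Vec n) (Vec n)))).add
    (hA2.integrable_map (matrixCompCLM (LinearMap.snd ℝ (Vec n) (Vec n))))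

/-- Multiplication by the matrix function `A`, as a linear map from `ℝⁿ` to `L₂(-1, 0; ℝⁿ)`. -/
noncomputable def mulL2Linear {A : ℝ → Matrix (Fin n) (Fin n) ℝ} (hA : MatrixL2 A) :
    Vec n →ₗ[ℝ] L2Vec n where
  toFun w := (hA.memLp_apply w).toLp _
  map_add' w v := by
    refine Eq.trans ?_ (MemLp.toLp_add (hA.memLp_apply w) (hA.memLp_apply v))
    exact MemLp.toLp_congr _ _ (Eventually.of_forall fun θ => map_add _ w v)
  map_smul' c w := by
    refine Eq.trans ?_ (MemLp.toLp_const_smul c (hA.memLp_apply w))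
    exact MemLp.toLp_congr _ _ (Eventually.of_forall fun θ => map_smul _ c w)

/-- Multiplication by the matrix function `A`, from `ℝⁿ` to `L₂(-1, 0; ℝⁿ)`. -/
noncomputable def mulL2 {A : ℝ → Matrix (Fin n) (Fin n) ℝ} (hA : MatrixL2 A) :
    Vec n →L[ℝ] L2Vec n :=
  (mulL2Linear hA).toContinuousLinearMap

theorem coeFn_mulL2 {A : ℝ → Matrix (Fin n) (Fin n) ℝ} (hA : MatrixL2 A) (w : Vec n) :
    mulL2 hA w =ᵐ[delayMeasure] fun θ => (A θ).toEuclideanLin w :=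
  (hA.memLp_apply w).coeFn_toLp

end Matrix

end NeutralType

/-! ### Integration by parts and the weak transport equation. -/

namespace NeutralType

variable {n : ℕ}

theorem absolutelyContinuousOnInterval_inner {r : ℝ → Vec n} {a b : ℝ}
    (hr : AbsolutelyContinuousOnInterval r a b) (e : Vec n) :
    AbsolutelyContinuousOnInterval (fun θ => inner ℝ e (r θ)) a b := by
  apply squeeze_zero (fun t ↦ ?_) (fun t ↦ ?_) (by simpa using Tendsto.const_mul ‖e‖ hr)
  · exact Finset.sum_nonneg fun i _ => dist_nonneg
  · rw [Finset.mul_sum]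
    refine Finset.sum_le_sum fun i _ => ?_
    rw [Real.dist_eq, dist_eq_norm, ← inner_sub_right]
    exact abs_real_inner_le_norm _ _

theorem integrable_shift_smul {k : ℝ → ℝ} (hk : Continuous k) (b : ℝ) {f : ℝ → Vec n}
    (hf : Integrable f delayMeasure) : Integrable (fun θ => k (θ + b) • f θ) delayMeasure := by
  have hc : Continuous fun θ => k (θ + b) := by fun_prop
  obtain ⟨C, hC⟩ := isCompact_Icc.exists_bound_of_continuousOn (s := Icc (-1 : ℝ) 0) hc.continuousOn
  refine hf.bdd_smul C hc.aestronglyMeasurable ?_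
  exact (ae_restrict_iff' measurableSet_Ioc).2
    (Eventually.of_forall fun θ hθ => hC θ (Ioc_subset_Icc_self hθ))

/-- Translates Hilbert space pairings into vector-valued integrals tested against `e`. -/
theorem inner_shiftL2 {k : ℝ → ℝ} (hk : Continuous k) (e : Vec n) (b : ℝ) {p : L2Vec n}
    {f : ℝ → Vec n} (hf : p =ᵐ[delayMeasure] f) :
    inner ℝ (shiftL2 hk e b) p = inner ℝ e (∫ θ, k (θ + b) • f θ ∂delayMeasure) := by
  have hfi : Integrable f delayMeasure := ((Lp.memLp p).integrable (by norm_num)).congr hf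
  rw [← integral_inner (integrable_shift_smul hk b hfi), L2.inner_def]
  refine integral_congr_ae ?_
  filter_upwards [hf, (memLp_shift_smul hk b e).coeFn_toLp] with θ h1 h2
  have h2' : shiftL2 hk e b θ = k (θ + b) • e := h2
  rw [h1, h2', real_inner_smul_left, real_inner_smul_right]

/-- Pairing with each vector `e` reduces this to scalar integration by parts for absolutely
continuous functions. -/
theorem MemH1.integral_deriv_smul {r : ℝ → Vec n} (hr : MemH1 r) {k : ℝ → ℝ} (hk : ContDiff ℝ 1 k)
    (b : ℝ) :
    ∫ θ, k (θ + b) • deriv r θ ∂delayMeasure + ∫ θ, deriv k (θ + b) • r θ ∂delayMeasure =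
      k b • r 0 - k (-1 + b) • r (-1) := by
  have hk' : Continuous (deriv k) := hk.continuous_deriv (by norm_num)
  have hri : Integrable r delayMeasure := by
    have h := hr.1.continuousOn
    rw [uIcc_of_le (by norm_num)] at h
    exact (h.integrableOn_compact isCompact_Icc).mono_set Ioc_subset_Icc_self
  have h1 := integrable_shift_smul hk.continuous b (hr.2.integrable (by norm_num))
  have h2 := integrable_shift_smul hk' b hri
  rw [← integral_add h1 h2]
  refine ext_inner_left ℝ fun e => ?_
  rw [← integral_inner (by exact h1.add h2), inner_sub_right, real_inner_smul_right, real_inner_smul_right]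
  have hkb : ContDiff ℝ 1 fun θ => k (θ + b) := hk.comp (contDiff_id.add contDiff_const)
  have hparts := AbsolutelyContinuousOnInterval.integral_deriv_mul_eq_sub
    (hkb.contDiffOn.absolutelyContinuousOnInterval (a := -1) (b := 0))
    (absolutelyContinuousOnInterval_inner hr.1 e)
  rw [zero_add, intervalIntegral.integral_of_le (by norm_num)] at hparts
  rw [← hparts]
  refine integral_congr_ae ?_
  filter_upwards [ae_differentiableAt_of_ac hr.1] with θ hθ
  have hd : deriv (fun θ => inner ℝ e (r θ)) θ = inner ℝ e (deriv r θ) := by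
    simpa using ((hasDerivAt_const θ e).inner ℝ hθ.hasDerivAt).deriv
  rw [hd, deriv_comp_add_const, inner_add_right, real_inner_smul_right,
    real_inner_smul_right, add_comm]

section Solution

variable {Am1 : Matrix (Fin n) (Fin n) ℝ} {A2 A3 : ℝ → Matrix (Fin n) (Fin n) ℝ}

theorem tildeA_fst (hA3 : MatrixL2 A3) (y : (tildeA Am1 A2 A3 hA3).domain) :
    (tildeA Am1 A2 A3 hA3 y).fst = h1Rep y 0 := rfl

theorem tildeA_snd (hA3 : MatrixL2 A3) (y : (tildeA Am1 A2 A3 hA3).domain) :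
    (tildeA Am1 A2 A3 hA3 y).snd =ᵐ[delayMeasure]
      fun θ => -deriv (h1Rep y) θ + (A3 θ).toEuclideanLin (y : M2 n).fst :=
  (memLp_value hA3 (y : M2 n).fst (h1Rep_spec y).1).coeFn_toLp

theorem h1Rep_neg_one (y : tildeADomain Am1 A2) :
    h1Rep y (-1) = Am1.toEuclideanLin (h1Rep y 0) :=
  (Classical.choose_spec y.2).2

theorem hasDerivWithinAt_fst {f : ℝ → M2 n} {f' : M2 n} {J : Set ℝ} {s : ℝ}
    (h : HasDerivWithinAt f f' J s) : HasDerivWithinAt (fun s => (f s).fst) f'.fst J s :=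
  (WithLp.fstL 2 ℝ (Vec n) (L2Vec n)).hasFDerivAt.comp_hasDerivWithinAt s h

theorem hasDerivWithinAt_snd {f : ℝ → M2 n} {f' : M2 n} {J : Set ℝ} {s : ℝ}
    (h : HasDerivWithinAt f f' J s) : HasDerivWithinAt (fun s => (f s).snd) f'.snd J s :=
  (WithLp.sndL 2 ℝ (Vec n) (L2Vec n)).hasFDerivAt.comp_hasDerivWithinAt s h

/-- The element `ψ + A₂ w` of `L₂(-1, 0; ℝⁿ)`, for `(w, ψ) = x`. -/
noncomputable def repL2 (hA2 : MatrixL2 A2) (x : M2 n) : L2Vec n := x.snd + mulL2 hA2 x.fst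

theorem IsH1Rep.repL2_ae (hA2 : MatrixL2 A2) {x : M2 n} {r : ℝ → Vec n} (hr : IsH1Rep A2 x r) :
    repL2 hA2 x =ᵐ[delayMeasure] r := by
  filter_upwards [hr.2, Lp.coeFn_add x.snd (mulL2 hA2 x.fst), coeFn_mulL2 hA2 x.fst] with θ h1 h2 h3
  rw [repL2, h2, Pi.add_apply, h3, h1]

theorem repL2_tildeA_ae (hA2 : MatrixL2 A2) (hA3 : MatrixL2 A3)
    (y : (tildeA Am1 A2 A3 hA3).domain) :
    repL2 hA2 (tildeA Am1 A2 A3 hA3 y) =ᵐ[delayMeasure] fun θ =>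
      -deriv (h1Rep y) θ + delayCLM A2 A3 θ ((y : M2 n).fst, h1Rep y 0) := by
  filter_upwards [tildeA_snd hA3 y, Lp.coeFn_add (tildeA Am1 A2 A3 hA3 y).snd
    (mulL2 hA2 (tildeA Am1 A2 A3 hA3 y).fst), coeFn_mulL2 hA2 (tildeA Am1 A2 A3 hA3 y).fst]
    with θ h1 h2 h3
  rw [repL2, h2, Pi.add_apply, h3, h1, delayCLM_apply, add_assoc, tildeA_fst]

theorem hasDerivWithinAt_repL2 (hA2 : MatrixL2 A2) {f : ℝ → M2 n} {f' : M2 n} {J : Set ℝ} {s : ℝ}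
    (h : HasDerivWithinAt f f' J s) :
    HasDerivWithinAt (fun s => repL2 hA2 (f s)) (repL2 hA2 f') J s :=
  (hasDerivWithinAt_snd h).add
    ((mulL2 hA2).hasFDerivAt.comp_hasDerivWithinAt s (hasDerivWithinAt_fst h))

/-- The weak form of the transport equation for `ψ + A₂ w`, along the characteristics. -/
theorem hasDerivWithinAt_inner_repL2 (hA2 : MatrixL2 A2) (hA3 : MatrixL2 A3) {x : ℝ → M2 n}
    {J : Set ℝ} {s : ℝ} (y : (tildeA Am1 A2 A3 hA3).domain) (hy : x s = y)
    (hx : HasDerivWithinAt x (tildeA Am1 A2 A3 hA3 y) J s)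
    {k : ℝ → ℝ} (hk : ContDiff ℝ 2 k) {C : ℝ} (hC : ∀ x, ‖deriv (deriv k) x‖ ≤ C) (e : Vec n)
    (b : ℝ) :
    HasDerivWithinAt (fun s => inner ℝ (shiftL2 hk.continuous e (b - s)) (repL2 hA2 (x s)))
      (inner ℝ e (k (-1 + (b - s)) • h1Rep y (-1) - k (b - s) • h1Rep y 0 +
        ∫ θ, k (θ + (b - s)) • delayCLM A2 A3 θ ((x s).fst, h1Rep y 0) ∂delayMeasure)) J s := by
  have hk1 : ContDiff ℝ 1 k := hk.of_le (by norm_num)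
  have hk' : Continuous (deriv k) := hk1.continuous_deriv (by norm_num)
  have hsub : HasDerivAt (fun s : ℝ => b - s) (-1) s := by
    simpa using (hasDerivAt_id s).const_sub b
  have h1 : HasDerivAt (fun s => shiftL2 hk.continuous e (b - s))
      ((-1 : ℝ) • shiftL2 hk' e (b - s)) s :=
    (hasDerivAt_shiftL2 hk hk' hC e (b - s)).scomp s hsub
  have h2 := h1.hasDerivWithinAt.inner ℝ (hasDerivWithinAt_repL2 hA2 hx)
  refine h2.congr_deriv (Eq.symm ?_)
  have hr := h1Rep_spec y
  have hR : repL2 hA2 (x s) =ᵐ[delayMeasure] h1Rep y := hy ▸ hr.repL2_ae hA2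
  have hR' := repL2_tildeA_ae hA2 hA3 y
  have hd : Integrable (deriv (h1Rep y)) delayMeasure := hr.1.2.integrable (by norm_num)
  have hq : Integrable (fun θ => delayCLM A2 A3 θ ((x s).fst, h1Rep y 0)) delayMeasure :=
    (integrable_delayCLM hA2 hA3).apply_continuousLinearMap _
  rw [real_inner_smul_left, inner_shiftL2 hk' e (b - s) hR, inner_shiftL2 hk.continuous e _ hR',
    neg_one_mul, ← inner_neg_right, ← inner_add_right]
  congr 1
  have hsum : ∫ θ, k (θ + (b - s)) • (-deriv (h1Rep y) θ +
      delayCLM A2 A3 θ ((y : M2 n).fst, h1Rep y 0)) ∂delayMeasure =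
      -∫ θ, k (θ + (b - s)) • deriv (h1Rep y) θ ∂delayMeasure +
        ∫ θ, k (θ + (b - s)) • delayCLM A2 A3 θ ((x s).fst, h1Rep y 0) ∂delayMeasure := by
    have := integral_add (integrable_shift_smul hk.continuous (b - s) hd).neg
      (integrable_shift_smul hk.continuous (b - s) hq)
    simp only [Pi.neg_apply, integral_neg] at this
    rw [← this]
    simp only [smul_add, smul_neg, hy]
  -- The motion of the test function contributes `-k' r` and the transport term `-k r'`; together
  -- they are the boundary terms.
  rw [hsum, ← neg_sub (k (b - s) • h1Rep y 0), ← hr.1.integral_deriv_smul hk1 (b - s)]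
  abel

end Solution

end NeutralType

/-! ### The identity averaged over characteristics, and its localisation. -/

namespace NeutralType

variable {n : ℕ} {Am1 : Matrix (Fin n) (Fin n) ℝ} {A2 A3 : ℝ → Matrix (Fin n) (Fin n) ℝ}
  {hA3 : MatrixL2 A3} {J : Set ℝ} {x : ℝ → M2 n}

theorem uniqueDiffOn_of_ordConnected (hJ : J.OrdConnected) (hJ' : J.Nontrivial) :
    UniqueDiffOn ℝ J :=
  uniqueDiffOn_convex hJ.convex ((Convex.nontrivial_iff_nonempty_interior hJ.convex).1 hJ')

theorem derivWithin_fst_eq (hx : IsClassicalSolutionOn (tildeA Am1 A2 A3 hA3) J x)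
    (hU : UniqueDiffOn ℝ J) {s : ℝ} (hs : s ∈ J) :
    derivWithin (fun t => (x t).fst) J s = h1Rep ⟨x s, hx.mem_domain s hs⟩ 0 :=
  (hasDerivWithinAt_fst (hx.hasDerivWithinAt s hs)).derivWithin (hU s hs)

theorem continuousOn_derivWithin_fst (hJ : J.OrdConnected)
    (hx : IsClassicalSolutionOn (tildeA Am1 A2 A3 hA3) J x) :
    ContinuousOn (derivWithin (fun t => (x t).fst) J) J := by
  -- On a degenerate interval `derivWithin` need not be the operator's first component, but
  -- continuity is trivial there.
  rcases J.subsingleton_or_nontrivial with h | h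
  · exact h.continuousOn _
  · rw [continuousOn_iff_continuous_domRestrict]
    refine ((WithLp.fstL 2 ℝ (Vec n) (L2Vec n)).continuous.comp hx.continuous_deriv).congr
      fun s => ?_
    exact (derivWithin_fst_eq hx (uniqueDiffOn_of_ordConnected hJ h) s.2).symm

/-- The bracket is the defect on characteristic `z`: initial value minus value on arrival at `θ = 0`
plus accumulated source. The globally defined `w` and `v` stand for the solution and its derivative
on `[t, t + 1]`. -/
theorem integral_smul_transport_eq_zero (hA2 : MatrixL2 A2)
    (hx : IsClassicalSolutionOn (tildeA Am1 A2 A3 hA3) J x) {t : ℝ} (htJ : Icc t (t + 1) ⊆ J)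
    (y : (tildeA Am1 A2 A3 hA3).domain) (hy : x t = y)
    {w v : ℝ → Vec n} (hw : Continuous w) (hv : Continuous v)
    (hwx : ∀ s ∈ Icc t (t + 1), w s = (x s).fst)
    (hvx : ∀ s (hs : s ∈ J), s ∈ Icc t (t + 1) → v s = h1Rep ⟨x s, hx.mem_domain s hs⟩ 0)
    {C : ℝ} (hC : ∀ s, ‖(w s, v s)‖ ≤ C) {k : ℝ → ℝ} (hk : ContDiff ℝ ∞ k)
    (hkc : HasCompactSupport k) (hk0 : ∀ y ∉ Ioo (0 : ℝ) 1, k y = 0) :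
    ∫ z in Ioo (0 : ℝ) 1, k z • (h1Rep y (z - 1) - v (1 + t - z) +
      triangleIntegral (delayCLM A2 A3) (fun s => (w s, v s)) (1 + t) z) = 0 := by
  have hkcont := hk.continuous
  have hk2 : ContDiff ℝ 2 k := contDiff_infty.1 hk 2
  obtain ⟨K, hK⟩ := hkcont.bounded_above_of_compact_support hkc
  obtain ⟨D, hD⟩ : ∃ D, ∀ x, ‖deriv (deriv k) x‖ ≤ D :=
    (hk.iterate_deriv 2).continuous.bounded_above_of_compact_support hkc.deriv.deriv
  have ha := integrable_delayCLM hA2 hA3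
  have hc : Continuous fun s => (w s, v s) := hw.prodMk hv
  -- The vector whose inner product with `e` is the time derivative of the pairing `F` below.
  set g : ℝ → Vec n := fun s => -(k (1 + t - s) • v s) +
    ∫ θ, k (θ + 1 + t - s) • delayCLM A2 A3 θ (w s, v s) ∂delayMeasure with hg
  have hg1 : Continuous fun s => k (1 + t - s) • v s := by fun_prop
  have hg2 : Continuous fun s =>
      ∫ θ, k (θ + 1 + t - s) • delayCLM A2 A3 θ (w s, v s) ∂delayMeasure := by
    refine continuous_of_dominated (bound := fun θ => K * (‖delayCLM A2 A3 θ‖ * C))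
      (fun s => ?_) (fun s => Eventually.of_forall fun θ => ?_)
      ((ha.norm.mul_const C).const_mul K) (Eventually.of_forall fun θ => by fun_prop)
    · exact (by fun_prop : Continuous fun θ => k (θ + 1 + t - s)).aestronglyMeasurable.smul
        (ha.apply_continuousLinearMap _).1
    · rw [norm_smul]
      have hK0 : 0 ≤ K := (norm_nonneg _).trans (hK 0)
      gcongr
      · exact hK _
      · exact (ContinuousLinearMap.le_opNorm _ _).trans (by gcongr; exact hC _)
  have hgc : Continuous g := hg1.neg.add hg2
  have hyr := h1Rep_spec y
  have hri : ContinuousOn (h1Rep y) (Icc (-1) 0) := by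
    have := hyr.1.1.continuousOn
    rwa [uIcc_of_le (by norm_num)] at this
  have main : ∫ s in t..(t + 1), g s = -∫ θ, k (θ + 1) • h1Rep y θ ∂delayMeasure := by
    refine ext_inner_left ℝ fun e => ?_
    set F : ℝ → ℝ := fun s =>
      inner ℝ (shiftL2 hkcont e (1 + t - s)) (repL2 hA2 (x s)) with hF
    have hderiv : ∀ s ∈ Icc t (t + 1), HasDerivWithinAt F (inner ℝ e (g s)) J s := by
      intro s hs
      refine (hasDerivWithinAt_inner_repL2 hA2 hA3 ⟨x s, hx.mem_domain s (htJ hs)⟩ rfl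
        (hx.hasDerivWithinAt s (htJ hs)) hk2 hD e (1 + t)).congr_deriv ?_
      -- The boundary term at `θ = -1` carries `k(t - s)` with `t - s ≤ 0`, outside the support.
      have h0 : k (-1 + (1 + t - s)) = 0 := hk0 _ fun h => by linarith [h.1, hs.1]
      rw [h0, zero_smul, zero_sub]
      simp only [hg, hvx s (htJ hs) hs, hwx s hs, ← add_sub_assoc, ← add_assoc]
      rfl
    have hFC : ContinuousOn F (Icc t (t + 1)) := fun s hs =>
      ((hderiv s hs).continuousWithinAt).mono htJ
    have hFTC := intervalIntegral.integral_eq_sub_of_hasDerivAt_of_le (by linarith) hFC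
      (fun s hs => (hderiv s (Ioo_subset_Icc_self hs)).hasDerivAt
        (mem_of_superset (Icc_mem_nhds hs.1 hs.2) htJ))
      ((continuous_const.inner hgc).intervalIntegrable _ _)
    -- By time `t + 1` every characteristic in the support has left: the kernel is `k(θ)` with `θ ≤
    -- 0`.
    have hF1 : F (t + 1) = 0 := by
      have htJ1 : t + 1 ∈ J := htJ (right_mem_Icc.2 (by linarith))
      simp only [hF]
      rw [inner_shiftL2 hkcont e _ ((h1Rep_spec ⟨x (t + 1), hx.mem_domain _ htJ1⟩).repL2_ae hA2),
        setIntegral_eq_zero_of_forall_eq_zero, inner_zero_right]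
      intro θ hθ
      rw [hk0, zero_smul]
      exact fun h => by linarith [h.1, hθ.2]
    have hF0 : F t = inner ℝ e (∫ θ, k (θ + 1) • h1Rep y θ ∂delayMeasure) := by
      simp only [hF]
      rw [hy, inner_shiftL2 hkcont e _ (hyr.repL2_ae hA2), add_sub_cancel_right]
    rw [hF1, hF0, zero_sub, intervalIntegral.integral_of_le (by linarith)] at hFTC
    rw [intervalIntegral.integral_of_le (by linarith), inner_neg_right, ← hFTC, integral_inner]
    exact (hgc.integrableOn_Icc (a := t) (b := t + 1)).mono_set Ioc_subset_Icc_self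
  have hv' : ∫ s in t..(t + 1), k (1 + t - s) • v s =
      ∫ z in Ioo (0 : ℝ) 1, k z • v (1 + t - z) := by
    have := intervalIntegral.integral_comp_sub_left (a := t) (b := t + 1)
      (fun z => k z • v (1 + t - z)) (1 + t)
    simp only [sub_sub_cancel] at this
    rw [this, show 1 + t - (t + 1) = 0 by ring, show 1 + t - t = 1 by ring,
      intervalIntegral.integral_of_le zero_le_one, integral_Ioc_eq_integral_Ioo]
  have hr' : ∫ θ, k (θ + 1) • h1Rep y θ ∂delayMeasure =
      ∫ z in Ioo (0 : ℝ) 1, k z • h1Rep y (z - 1) := by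
    rw [← integral_Ioc_eq_integral_Ioo, ← intervalIntegral.integral_of_le zero_le_one,
      ← intervalIntegral.integral_of_le (by norm_num)]
    have := intervalIntegral.integral_comp_add_right (a := -1) (b := 0)
      (fun z => k z • h1Rep y (z - 1)) 1
    simpa using this
  have hQ := integral_kernel_eq_triangleIntegral ha hc hC hkcont hkc hk0 t
  simp only [hg] at main
  rw [intervalIntegral.integral_add (by exact hg1.neg.intervalIntegrable _ _)
    (hg2.intervalIntegrable _ _), intervalIntegral.integral_neg, hv', hr',
    intervalIntegral.integral_of_le (by linarith), hQ] at main
  have hsub : MapsTo (fun z : ℝ => z - 1) (Icc 0 1) (Icc (-1) 0) := fun z hz =>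
    ⟨by linarith [hz.1], by linarith [hz.2]⟩
  have i1 : IntegrableOn (fun z => k z • h1Rep y (z - 1)) (Ioo 0 1) :=
    ((hkcont.continuousOn.smul (hri.comp (by fun_prop) hsub)).integrableOn_compact
      isCompact_Icc).mono_set Ioo_subset_Icc_self
  have i2 : IntegrableOn (fun z => k z • v (1 + t - z)) (Ioo 0 1) :=
    (by fun_prop : Continuous fun z => k z • v (1 + t - z)).integrableOn_Icc.mono_set
      Ioo_subset_Icc_self
  have i3 : IntegrableOn (fun z => k z •
      triangleIntegral (delayCLM A2 A3) (fun s => (w s, v s)) (1 + t) z) (Ioo 0 1) :=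
    (hkcont.smul (continuous_triangleIntegral ha hc hC (1 + t))).integrableOn_Icc.mono_set
      Ioo_subset_Icc_self
  simp only [smul_add, smul_sub]
  rw [integral_add (by exact i1.sub i2) i3, integral_sub i1 i2]
  rw [neg_add_eq_sub, sub_eq_iff_eq_add] at main
  rw [main]
  abel

/-- The fundamental lemma of the calculus of variations gives zero almost everywhere; continuity
extends this to the end points. -/
theorem eqOn_zero_of_integral_smul_eq_zero {Z : ℝ → Vec n} (hZ : ContinuousOn Z (Icc 0 1))
    (h : ∀ k : ℝ → ℝ, ContDiff ℝ ∞ k → HasCompactSupport k → (∀ y ∉ Ioo (0 : ℝ) 1, k y = 0) →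
      ∫ z in Ioo (0 : ℝ) 1, k z • Z z = 0) : EqOn Z 0 (Icc 0 1) := by
  refine Measure.eqOn_Icc_of_ae_eq volume zero_ne_one ?_ hZ continuousOn_const
  rw [← Measure.restrict_congr_set (Ioo_ae_eq_Icc (a := (0 : ℝ)) (b := 1))]
  refine (ae_restrict_iff' measurableSet_Ioo).2 ?_
  refine isOpen_Ioo.ae_eq_zero_of_integral_contDiff_smul_eq_zero
    ((hZ.mono Ioo_subset_Icc_self).locallyIntegrableOn measurableSet_Ioo) fun k hk hkc hks => ?_
  have hk0 : ∀ y ∉ Ioo (0 : ℝ) 1, k y = 0 := fun y hy => image_eq_zero_of_notMem_tsupport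
    fun h' => hy (hks h')
  rw [← setIntegral_eq_integral_of_forall_compl_eq_zero (s := Ioo 0 1) fun z hz => by
    rw [hk0 z hz, zero_smul]]
  exact h k hk hkc hk0

end NeutralType

/-! ### The neutral equation, read off from the characteristic `z = 0`. -/

theorem mainTheorem6 (n : ℕ) (Am1 : Matrix (Fin n) (Fin n) ℝ)
    (A2 A3 : ℝ → Matrix (Fin n) (Fin n) ℝ)
    (hA2 : NeutralType.MatrixL2 A2) (hA3 : NeutralType.MatrixL2 A3)
    (J : Set ℝ) (hJ : J.OrdConnected) (x : ℝ → NeutralType.M2 n)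
    (hx : NeutralType.IsClassicalSolutionOn (NeutralType.tildeA Am1 A2 A3 hA3) J x) :
    NeutralType.IsNeutralSolutionOn Am1 A2 A3 J (fun t => (x t).fst) := by
  open NeutralType in
  have hdiff : DifferentiableOn ℝ (fun t => (x t).fst) J := fun t ht =>
    (hasDerivWithinAt_fst (hx.hasDerivWithinAt t ht)).differentiableWithinAt
  have hcont := continuousOn_derivWithin_fst hJ hx
  have key : ∀ t (ht : t ∈ J) (ht1 : t + 1 ∈ J),
      IntegrableOn (fun τ => (A2 τ).toEuclideanLin
          (derivWithin (fun t => (x t).fst) J (t + 1 + τ)) +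
        (A3 τ).toEuclideanLin (x (t + 1 + τ)).fst) (Ioc (-1) 0) ∧
      derivWithin (fun t => (x t).fst) J (t + 1) =
        Am1.toEuclideanLin (derivWithin (fun t => (x t).fst) J t) +
        ∫ τ in (-1 : ℝ)..0, ((A2 τ).toEuclideanLin
          (derivWithin (fun t => (x t).fst) J (t + 1 + τ)) +
          (A3 τ).toEuclideanLin (x (t + 1 + τ)).fst) := by
    intro t ht ht1
    have hle : t ≤ t + 1 := by linarith
    have htJ : Icc t (t + 1) ⊆ J := hJ.out ht ht1
    have hU := uniqueDiffOn_of_ordConnected hJ ⟨t, ht, t + 1, ht1, by linarith⟩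
    -- Constant extension beyond `[t, t + 1]` gives bounded continuous functions on the whole line,
    -- as domination and Fubini require.
    set w : ℝ → Vec n := IccExtend hle ((Icc t (t + 1)).domRestrict fun t => (x t).fst) with hw
    set v : ℝ → Vec n :=
      IccExtend hle ((Icc t (t + 1)).domRestrict (derivWithin (fun t => (x t).fst) J)) with hv
    have hwc : Continuous w := (hdiff.continuousOn.mono htJ).domRestrict.Icc_extend'
    have hvc : Continuous v := (hcont.mono htJ).domRestrict.Icc_extend'
    have hwx : ∀ s ∈ Icc t (t + 1), w s = (x s).fst := fun s hs => IccExtend_of_mem hle _ hs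
    have hvx : ∀ s ∈ Icc t (t + 1), v s = derivWithin (fun t => (x t).fst) J s :=
      fun s hs => IccExtend_of_mem hle _ hs
    have hc : Continuous fun s => (w s, v s) := hwc.prodMk hvc
    obtain ⟨C, hC⟩ : ∃ C, ∀ s, ‖(w s, v s)‖ ≤ C := by
      obtain ⟨C, hC⟩ := isCompact_Icc.exists_bound_of_continuousOn (s := Icc t (t + 1))
        hc.continuousOn
      refine ⟨C, fun s => ?_⟩
      have := hC _ (projIcc t (t + 1) hle s).2
      simpa only [hw, hv, IccExtend, Function.comp_apply, projIcc_val] using this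
    have ha := integrable_delayCLM hA2 hA3
    let y : (tildeA Am1 A2 A3 hA3).domain := ⟨x t, hx.mem_domain t ht⟩
    have hZ : ContinuousOn (fun z => h1Rep y (z - 1) - v (1 + t - z) +
        triangleIntegral (delayCLM A2 A3) (fun s => (w s, v s)) (1 + t) z) (Icc 0 1) := by
      have hri : ContinuousOn (h1Rep y) (Icc (-1) 0) := by
        have := (h1Rep_spec y).1.1.continuousOn
        rwa [uIcc_of_le (by norm_num)] at this
      have hsub : MapsTo (fun z : ℝ => z - 1) (Icc 0 1) (Icc (-1) 0) := fun z hz =>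
        ⟨by linarith [hz.1], by linarith [hz.2]⟩
      exact ((hri.comp (by fun_prop) hsub).sub
        (by fun_prop : Continuous fun z => v (1 + t - z)).continuousOn).add
        (continuous_triangleIntegral ha hc hC (1 + t)).continuousOn
    -- The defect at `z = 0`, an end point that no test function sees directly.
    have h0 := eqOn_zero_of_integral_smul_eq_zero hZ (fun k hk hkc hk0 =>
      integral_smul_transport_eq_zero hA2 hx htJ y rfl hwc hvc hwx
        (fun s hs hs' => (hvx s hs').trans (derivWithin_fst_eq hx hU hs)) hC hk hkc hk0)
      (left_mem_Icc.2 zero_le_one)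
    -- At `y = 0` the cutoff is inactive, since `θ > -1` throughout the half-open delay interval.
    have hae : (fun θ => if (0 : ℝ) < θ + 1 then
        delayCLM A2 A3 θ (w (θ + (1 + t) - 0), v (θ + (1 + t) - 0)) else 0)
        =ᵐ[delayMeasure] fun τ => (A2 τ).toEuclideanLin
          (derivWithin (fun t => (x t).fst) J (t + 1 + τ)) +
        (A3 τ).toEuclideanLin (x (t + 1 + τ)).fst := by
      refine (ae_restrict_iff' measurableSet_Ioc).2 (Filter.Eventually.of_forall fun θ hθ => ?_)
      have hmem : t + 1 + θ ∈ Icc t (t + 1) := ⟨by linarith [hθ.1], by linarith [hθ.2]⟩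
      have hpos : 0 < θ + 1 := by linarith [hθ.1]
      simp only [if_pos hpos]
      rw [show θ + (1 + t) - 0 = t + 1 + θ by ring, delayCLM_apply,
        hwx _ hmem, hvx _ hmem, add_comm]
    constructor
    · refine Integrable.congr ?_ hae
      refine Integrable.mono' (ha.norm.mul_const C)
        (aestronglyMeasurable_ite_apply ha hc (1 + t) 0) (Filter.Eventually.of_forall fun θ => ?_)
      have hC0 : 0 ≤ C := (norm_nonneg _).trans (hC 0)
      split_ifs
      · exact (ContinuousLinearMap.le_opNorm _ _).trans (by gcongr; exact hC _)
      · simpa using mul_nonneg (norm_nonneg _) hC0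
    · rw [intervalIntegral.integral_of_le (by norm_num), ← integral_congr_ae hae]
      have h1 : h1Rep y (0 - 1) = Am1.toEuclideanLin (derivWithin (fun t => (x t).fst) J t) := by
        rw [zero_sub, derivWithin_fst_eq hx hU ht]
        exact h1Rep_neg_one _
      have h2 : v (1 + t - 0) = derivWithin (fun t => (x t).fst) J (t + 1) := by
        rw [sub_zero, add_comm, hvx _ (right_mem_Icc.2 hle)]
      simp only [h1, h2, Pi.zero_apply] at h0
      rw [sub_add_eq_add_sub, sub_eq_zero] at h0
      exact h0.symm
  exact
    { differentiableOn := hdiff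
      continuousOn_deriv := hcont
      integrable := fun t ht ht1 =>
        (intervalIntegrable_iff_integrableOn_Ioc_of_le (by norm_num)).2 (key t ht ht1).1
      equation := fun t ht ht1 => (key t ht ht1).2 }
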